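/- Let $d\ge 1$ and $\alpha<0$. For a test function $\psi\in\mathcal D(\mathbb R^d)$, $x\in\mathbb R^d$ and $\lambda>0$ put $\psi_x^{\lambda}(y)=\lambda^{-d}\psi\big(\tfrac{x-y}{\lambda}\big)$. For $r\in\mathbb N$ let $\mathcal B^r$ be the set of all $\psi\in\mathcal D(\mathbb R^d)$ supported in the open unit ball $B(0,1)$ with $\|\psi\|_{C^r}\le 1$, i.e. all derivatives of $\psi$ of order at most $r$ are bounded by $1$. Fix any $r\in\mathbb N$ with $r>-\alpha$. For $p,q\in[1,\infty]$ let $B^\alpha_{p,q,\mathrm{loc}}(\mathbb R^d)$ be the space of distributions $f\in\mathcal D'(\mathbb R^d)$ such that for every compact set $K\subset\mathbb R^d$ $$\left\|\,\left\|\sup_{\psi\in\mathcal B^r}\left|\frac{f(\psi_x^{2^{-n}})}{2^{-n\alpha}}\right|\,\right\|_{L^p(x\in K)}\right\|_{\ell^q(n\ge 0)}<\infty .$$ For $s\in\mathbb R$ let $H^s(\mathbb R^d)$ be the space of tempered distributions $u$ with $\mathcal F^{-1}\big((1+|\xi|^2)^{s/2}\,\widehat u\,\big)\in L^2(\mathbb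 R^d)$, and let $H^s_{\mathrm{loc}}(\mathbb R^d)$ be the space of $u\in\mathcal D'(\mathbb R^d)$ with $\varphi u\in H^s(\mathbb R^d)$ for every $\varphi\in\mathcal D(\mathbb R^d)$. Let $p\in[2,\infty]$. Then: (a) if $q\in(2,\infty]$, then $B^\alpha_{p,q,\mathrm{loc}}(\mathbb R^d)\subset H^s_{\mathrm{loc}}(\mathbb R^d)$ for every $s<\alpha$; (b) if $q=2$, then $B^\alpha_{p,2,\mathrm{loc}}(\mathbb R^d)\subset H^s_{\mathrm{loc}}(\mathbb R^d)$ for every $s\le\alpha$. -/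

import Mathlib

open Set MeasureTheory TopologicalSpace
open scoped ENNReal Distributions SchwartzMap

noncomputable section

/-- Euclidean space of dimension `d`. -/
abbrev Euc (d : ℕ) : Type := EuclideanSpace ℝ (Fin d)

/-- Smooth compactly supported functions on Euclidean space. As in Mathlib, test functions are
real-valued; distributions below are complex-valued and extend by complex linearity to complex
test functions. -/
abbrev TestFn (d : ℕ) : Type := 𝓓((⊤ : Opens (Euc d)), ℝ)

/-- Complex-valued distributions on Euclidean space. -/
abbrev Distr (d : ℕ) : Type := 𝓓'((⊤ : Opens (Euc d)), ℂ)

/-- The rescaled, recentred test function `y ↦ lam⁻ᵈ ψ ((x - y) / lam)`. -/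
def rescaleTest {d : ℕ} (ψ : TestFn d) (lam : ℝ) (hlam : 0 < lam) (x : Euc d) : TestFn d where
  toFun y := (lam ^ d)⁻¹ * ψ (lam⁻¹ • (x - y))
  contDiff' := by
    have h : ContDiff ℝ ((⊤ : ℕ∞) : WithTop ℕ∞) (fun y : Euc d => lam⁻¹ • (x - y)) := by
      fun_prop
    exact contDiff_const.mul (ψ.contDiff.comp h)
  hasCompactSupport' := by
    have h : HasCompactSupport (fun y : Euc d => ψ (lam⁻¹ • (x - y))) :=
      ψ.hasCompactSupport.comp_homeomorph
        ((Homeomorph.subLeft x).trans (Homeomorph.smulOfNeZero lam⁻¹ (inv_ne_zero hlam.ne')))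
    exact h.mul_left
  tsupport_subset' := subset_univ _

/-- The pointwise product of two test functions. -/
def mulTest {d : ℕ} (φ g : TestFn d) : TestFn d where
  toFun y := φ y * g y
  contDiff' := φ.contDiff.mul g.contDiff
  hasCompactSupport' := g.hasCompactSupport.mul_left
  tsupport_subset' := subset_univ _

/-- A test function, seen as a (complex-valued) Schwartz function. -/
def testToSchwartz {d : ℕ} (g : TestFn d) : 𝓢(Euc d, ℂ) :=
  HasCompactSupport.toSchwartzMap (f := fun y => ((g y : ℝ) : ℂ))
    (g.hasCompactSupport.comp_left Complex.ofReal_zero)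
    (Complex.ofRealCLM.contDiff.comp g.contDiff)

/-- The class `𝓑ʳ`: test functions supported in the open unit ball, all of whose derivatives
up to order `r` are bounded by one. -/
def unitTests (d r : ℕ) : Set (TestFn d) :=
  {ψ | tsupport ψ ⊆ Metric.ball 0 1 ∧
    ∀ m ≤ r, ∀ y, ‖iteratedFDeriv ℝ m (ψ : Euc d → ℝ) y‖ ≤ 1}

/-- The function `x ↦ sup_{ψ ∈ 𝓑ʳ} |f(ψ_x^{2⁻ⁿ}) / 2^{-nα}|`, with values in `[0, ∞]`. -/
def besovLevel {d : ℕ} (r : ℕ) (α : ℝ) (f : Distr d) (n : ℕ) (x : Euc d) : ℝ≥0∞ :=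
  ⨆ ψ ∈ unitTests d r,
    ‖f (rescaleTest ψ ((2 : ℝ) ^ (-(n : ℝ))) (by positivity) x)‖ₑ /
      (2 : ℝ≥0∞) ^ (-((n : ℝ) * α))

/-- The local Besov space `B^α_{p,q,loc}` of negative regularity `α < 0`, defined with the help
of some natural number `r > -α`: for every compact `K`, the `ℓ^q` norm in `n` of the `L^p(K)`
norms of `besovLevel` is finite. -/
def besovLocNeg (d r : ℕ) (α : ℝ) (p q : ℝ≥0∞) : Set (Distr d) :=
  {f | ∀ K : Set (Euc d), IsCompact K →
    eLpNorm (fun n : ℕ => eLpNorm (besovLevel r α f n) p (volume.restrict K)) q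
      Measure.count < ∞}

/-- The local Sobolev space `H^s_loc`: distributions `f` such that for every test function `φ`
the product `φ f`, i.e. `g ↦ f (φ g)`, is (the restriction to test functions of) a tempered
distribution in `H^s`. Such a tempered distribution is unique, by density of test functions. -/
def sobolevLoc (d : ℕ) (s : ℝ) : Set (Distr d) :=
  {f | ∀ φ : TestFn d, ∃ v : 𝓢'(Euc d, ℂ),
    (∀ g : TestFn d, v (testToSchwartz g) = f (mulTest φ g)) ∧
      TemperedDistribution.MemSobolev s 2 v}

end

/-! The distribution `φ f` has compact support, so its Fourier transform `V = localFourier f φ` is a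
continuous function of polynomial growth. Fix a test function `ρ` in the unit ball with integral
one, and let `ρ_n` be its rescaling to scale `2⁻ⁿ`. The convolution `φ f * ρ_n` at `x` is `f (φ
ρ_{n,x})`, and its Fourier transform is `ρ̂(2⁻ⁿ ξ) V(ξ)` (`apply_mulTest_rescaleTest`).

The factor `φ` can be absorbed into `ρ` at uniform cost, so the convolution is at most `C 2^{-nα}`
times the Besov level (`exists_enorm_apply_mulTest_rescaleTest_le`). It lives on a fixed compact
set, so Plancherel and Hölder (`p ≥ 2`) bound `‖ρ̂(2⁻ⁿ ·) V‖₂` by `C 2^{-nα}` times the local `L^p`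
norm of the level (`exists_eLpNorm_dilatedFourier_mul_le`).

As `s < 0`, low-pass pieces suffice and no annular decomposition is needed: at the first `n` for
which `2⁻ⁿ ξ` is small, `|ρ̂(2⁻ⁿ ξ)| ≥ 1/2` and the Sobolev weight is at most `C 2^{ns}`
(`memLp_weighted_localFourier`). It remains to sum `2^{2n(s-α)}` times squared levels: by a
geometric series if `s < α`, by the `ℓ²` condition itself if `s ≤ α`. -/

noncomputable section

open scoped ContDiff FourierTransform

/-! ### Complex-linear pairing with `φ f` -/

/-- The product of a test function and a smooth function, as a test function. -/
def smoothMulTest {d : ℕ} (φ : TestFn d) (g : Euc d → ℝ) (hg : ContDiff ℝ ∞ g) : TestFn d where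
  toFun y := φ y * g y
  contDiff' := φ.contDiff.mul hg
  hasCompactSupport' := φ.hasCompactSupport.mul_right
  tsupport_subset' := subset_univ _

/-- The complex vector space of smooth complex-valued functions. -/
def smoothFns (d : ℕ) : Submodule ℂ (Euc d → ℂ) where
  carrier := {g | ContDiff ℝ ∞ g}
  add_mem' {f g} (hf : ContDiff ℝ ∞ f) (hg : ContDiff ℝ ∞ g) := hf.add hg
  zero_mem' := show ContDiff ℝ ∞ (fun _ : Euc d => (0 : ℂ)) from contDiff_const
  smul_mem' c g (hg : ContDiff ℝ ∞ g) := hg.const_smul c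

lemma smoothFns_contDiff {d : ℕ} (g : smoothFns d) : ContDiff ℝ ∞ (g : Euc d → ℂ) := g.2

lemma contDiff_re {d : ℕ} (g : smoothFns d) : ContDiff ℝ ∞ fun y => (g.1 y).re :=
  Complex.reCLM.contDiff.comp (smoothFns_contDiff g)

lemma contDiff_im {d : ℕ} (g : smoothFns d) : ContDiff ℝ ∞ fun y => (g.1 y).im :=
  Complex.imCLM.contDiff.comp (smoothFns_contDiff g)

/-- The functional `g ↦ f (φ g)`, extended complex-linearly to all smooth functions. -/
def localPairing {d : ℕ} (f : Distr d) (φ : TestFn d) : smoothFns d →ₗ[ℂ] ℂ where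
  toFun g :=
    f (smoothMulTest φ (fun y => (g.1 y).re) (contDiff_re g)) +
      Complex.I * f (smoothMulTest φ (fun y => (g.1 y).im) (contDiff_im g))
  map_add' g h := by
    have h1 : smoothMulTest φ (fun y => ((g + h).1 y).re)
          (contDiff_re (g + h)) =
        smoothMulTest φ (fun y => (g.1 y).re) (contDiff_re g) +
        smoothMulTest φ (fun y => (h.1 y).re) (contDiff_re h) := by
      ext y
      change φ y * (g.1 y + h.1 y).re = φ y * (g.1 y).re + φ y * (h.1 y).re
      rw [Complex.add_re]; ring
    have h2 : smoothMulTest φ (fun y => ((g + h).1 y).im)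
          (contDiff_im (g + h)) =
        smoothMulTest φ (fun y => (g.1 y).im) (contDiff_im g) +
        smoothMulTest φ (fun y => (h.1 y).im) (contDiff_im h) := by
      ext y
      change φ y * (g.1 y + h.1 y).im = φ y * (g.1 y).im + φ y * (h.1 y).im
      rw [Complex.add_im]; ring
    rw [h1, h2, map_add, map_add]; ring
  map_smul' c g := by
    have h1 : smoothMulTest φ (fun y => ((c • g).1 y).re)
          (contDiff_re (c • g)) =
        c.re • smoothMulTest φ (fun y => (g.1 y).re) (contDiff_re g) +
        (-c.im) • smoothMulTest φ (fun y => (g.1 y).im) (contDiff_im g) := by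
      ext y
      change φ y * (c * g.1 y).re = c.re * (φ y * (g.1 y).re) + (-c.im) * (φ y * (g.1 y).im)
      rw [Complex.mul_re]; ring
    have h2 : smoothMulTest φ (fun y => ((c • g).1 y).im)
          (contDiff_im (c • g)) =
        c.re • smoothMulTest φ (fun y => (g.1 y).im) (contDiff_im g) +
        c.im • smoothMulTest φ (fun y => (g.1 y).re) (contDiff_re g) := by
      ext y
      change φ y * (c * g.1 y).im = c.re * (φ y * (g.1 y).im) + c.im * (φ y * (g.1 y).re)
      rw [Complex.mul_im]; ring
    rw [h1, h2, map_add, map_add, map_smul, map_smul, map_smul, map_smul]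
    simp only [Complex.real_smul, smul_eq_mul, RingHom.id_apply]
    push_cast
    conv_rhs => rw [← Complex.re_add_im c]
    linear_combination (-(c.im : ℂ) *
      f (smoothMulTest φ (fun y => (g.1 y).im) (contDiff_im g))) * Complex.I_sq

/-! ### Jets over a compact set -/

/-- The space of continuous jets of order `L` over the compact set `K`. -/
def JetSpace {d : ℕ} (K : Compacts (Euc d)) (L : ℕ) : Type :=
  Π i : Fin (L + 1), C(K, Euc d [×i]→L[ℝ] ℂ)

instance {d : ℕ} (K : Compacts (Euc d)) (L : ℕ) : NormedAddCommGroup (JetSpace K L) :=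
  inferInstanceAs (NormedAddCommGroup (Π i : Fin (L + 1), C(K, Euc d [×i]→L[ℝ] ℂ)))

instance {d : ℕ} (K : Compacts (Euc d)) (L : ℕ) : NormedSpace ℂ (JetSpace K L) :=
  inferInstanceAs (NormedSpace ℂ (Π i : Fin (L + 1), C(K, Euc d [×i]→L[ℝ] ℂ)))

instance {d : ℕ} (K : Compacts (Euc d)) (L : ℕ) : CompleteSpace (JetSpace K L) :=
  inferInstanceAs (CompleteSpace (Π i : Fin (L + 1), C(K, Euc d [×i]→L[ℝ] ℂ)))

/-- The components of a jet. -/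
def JetSpace.proj {d : ℕ} {K : Compacts (Euc d)} {L : ℕ} (i : Fin (L + 1)) :
    JetSpace K L →L[ℂ] C(K, Euc d [×i]→L[ℝ] ℂ) :=
  ContinuousLinearMap.proj (φ := fun i : Fin (L + 1) => C(K, Euc d [×i]→L[ℝ] ℂ)) i

lemma JetSpace.ext {d : ℕ} {K : Compacts (Euc d)} {L : ℕ} {a b : JetSpace K L}
    (h : ∀ i x, JetSpace.proj i a x = JetSpace.proj i b x) : a = b :=
  funext fun i => ContinuousMap.ext (h i)

lemma JetSpace.continuous_of_proj {d : ℕ} {K : Compacts (Euc d)} {L : ℕ} {X : Type*}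
    [TopologicalSpace X] {F : X → JetSpace K L}
    (h : ∀ i, Continuous fun x => JetSpace.proj i (F x)) : Continuous F :=
  continuous_pi h

lemma JetSpace.norm_proj_le {d : ℕ} {K : Compacts (Euc d)} {L : ℕ} (a : JetSpace K L)
    (i : Fin (L + 1)) : ‖JetSpace.proj i a‖ ≤ ‖a‖ :=
  norm_le_pi_norm (G := fun i : Fin (L + 1) => C(K, Euc d [×i]→L[ℝ] ℂ)) a i

lemma JetSpace.norm_le {d : ℕ} {K : Compacts (Euc d)} {L : ℕ} {a : JetSpace K L} {C : ℝ}
    (hC : 0 ≤ C) (h : ∀ i x, ‖JetSpace.proj i a x‖ ≤ C) : ‖a‖ ≤ C :=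
  (pi_norm_le_iff_of_nonneg (G := fun i : Fin (L + 1) => C(K, Euc d [×i]→L[ℝ] ℂ)) hC).2
    fun i => (ContinuousMap.norm_le _ hC).2 (h i)

/-- The derivatives up to order `L` of a smooth function, restricted to the compact set `K`. -/
def jet {d : ℕ} (K : Compacts (Euc d)) (L : ℕ) : smoothFns d →ₗ[ℂ] JetSpace K L where
  toFun g i := ⟨fun x => iteratedFDeriv ℝ i g.1 x,
    ((smoothFns_contDiff g).continuous_iteratedFDeriv (mod_cast le_top)).comp
      continuous_subtype_val⟩
  map_add' g h := by
    refine JetSpace.ext fun i x => ?_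
    exact iteratedFDeriv_add_apply ((smoothFns_contDiff g).of_le (mod_cast le_top)).contDiffAt
      ((smoothFns_contDiff h).of_le (mod_cast le_top)).contDiffAt
  map_smul' c g := by
    refine JetSpace.ext fun i x => ?_
    exact iteratedFDeriv_const_smul_apply
      ((smoothFns_contDiff g).of_le (mod_cast le_top)).contDiffAt

lemma jet_apply {d : ℕ} (K : Compacts (Euc d)) (L : ℕ) (g : smoothFns d) (i : Fin (L + 1))
    (x : K) : JetSpace.proj i (jet K L g) x = iteratedFDeriv ℝ i g.1 x := rfl

lemma norm_iteratedFDeriv_le_norm_jet {d : ℕ} (K : Compacts (Euc d)) (L : ℕ) (g : smoothFns d)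
    {i : ℕ} (hi : i ≤ L) {x : Euc d} (hx : x ∈ K) :
    ‖iteratedFDeriv ℝ i g.1 x‖ ≤ ‖jet K L g‖ :=
  ((JetSpace.proj ⟨i, by omega⟩ (jet K L g)).norm_coe_le_norm ⟨x, hx⟩).trans
    (JetSpace.norm_proj_le _ _)

lemma norm_jet_le {d : ℕ} (K : Compacts (Euc d)) (L : ℕ) (g : smoothFns d) {C : ℝ} (hC : 0 ≤ C)
    (h : ∀ i ≤ L, ∀ x ∈ K, ‖iteratedFDeriv ℝ i g.1 x‖ ≤ C) : ‖jet K L g‖ ≤ C :=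
  JetSpace.norm_le hC fun i x => h i (by omega) x x.2

/-! ### Finite order, and factorization through jets -/

/-- The compact support of a test function. -/
def testSupport {d : ℕ} (φ : TestFn d) : Compacts (Euc d) := ⟨tsupport φ, φ.hasCompactSupport⟩

lemma TestFunction.exists_norm_iteratedFDeriv_le {d : ℕ} (φ : TestFn d) (L : ℕ) :
    ∃ C : ℝ, 0 ≤ C ∧ ∀ i ≤ L, ∀ y, ‖iteratedFDeriv ℝ i φ y‖ ≤ C := by
  have h (i : ℕ) : ∃ C : ℝ, ∀ y, ‖iteratedFDeriv ℝ i φ y‖ ≤ C :=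
    Continuous.bounded_above_of_compact_support
      (φ.contDiff.continuous_iteratedFDeriv (mod_cast le_top))
      (φ.hasCompactSupport.iteratedFDeriv i)
  choose C hC using h
  refine ⟨∑ i ∈ Finset.range (L + 1), C i, Finset.sum_nonneg fun i _ =>
    (norm_nonneg _).trans (hC i 0), fun i hi y => (hC i y).trans ?_⟩
  exact Finset.single_le_sum (f := C) (fun i _ => (norm_nonneg _).trans (hC i 0))
    (Finset.mem_range.2 (by omega))

/-- A product of two functions with derivatives bounded by `A` and `B`. -/
lemma norm_iteratedFDeriv_mul_le_of_le {E : Type*} [NormedAddCommGroup E] [NormedSpace ℝ E]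
    {f g : E → ℝ} (hf : ContDiff ℝ ∞ f) (hg : ContDiff ℝ ∞ g) {L n : ℕ} (hn : n ≤ L) {x : E}
    {A B : ℝ} (hA : ∀ i ≤ L, ‖iteratedFDeriv ℝ i f x‖ ≤ A)
    (hB : ∀ i ≤ L, ‖iteratedFDeriv ℝ i g x‖ ≤ B) :
    ‖iteratedFDeriv ℝ n (fun y => f y * g y) x‖ ≤ 2 ^ L * (A * B) := by
  have hA0 : 0 ≤ A := (norm_nonneg _).trans (hA 0 (by omega))
  have hB0 : 0 ≤ B := (norm_nonneg _).trans (hB 0 (by omega))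
  calc _ ≤ ∑ i ∈ Finset.range (n + 1),
        (n.choose i : ℝ) * ‖iteratedFDeriv ℝ i f x‖ * ‖iteratedFDeriv ℝ (n - i) g x‖ :=
        norm_iteratedFDeriv_mul_le hf hg x (mod_cast le_top)
    _ ≤ ∑ i ∈ Finset.range (n + 1), (n.choose i : ℝ) * (A * B) := by
        refine Finset.sum_le_sum fun i hi => ?_
        have hi' := Finset.mem_range.1 hi
        rw [mul_assoc]
        gcongr
        · exact hA i (by omega)
        · exact hB (n - i) (by omega)
    _ = 2 ^ n * (A * B) := by
        rw [← Finset.sum_mul]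
        congr 1
        exact_mod_cast Nat.sum_range_choose n
    _ ≤ _ := by
        gcongr
        norm_num

/-- A distribution is of finite order on test functions supported in a fixed compact set. -/
lemma exists_norm_distribution_le {d : ℕ} (f : Distr d) (K : Compacts (Euc d)) :
    ∃ (L : ℕ) (C : ℝ), 0 ≤ C ∧ ∀ (h : TestFn d), tsupport h ⊆ K → ∀ B : ℝ, 0 ≤ B →
      (∀ i ≤ L, ∀ x ∈ K, ‖iteratedFDeriv ℝ i h x‖ ≤ B) → ‖f h‖ ≤ C * B := by
  have hK : (K : Set (Euc d)) ⊆ (⊤ : Opens (Euc d)) := subset_univ _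
  let T : 𝓓_{K}(Euc d, ℝ) →ₗ[ℝ] ℂ :=
    { toFun := fun h => f (TestFunction.ofSupportedIn hK h)
      map_add' := fun a b =>
        map_add f (TestFunction.ofSupportedIn hK a) (TestFunction.ofSupportedIn hK b)
      map_smul' := fun c a => map_smul f c (TestFunction.ofSupportedIn hK a) }
  have hT : Continuous T := f.continuous.comp (TestFunction.continuous_ofSupportedIn hK)
  obtain ⟨s, C, -, hC⟩ := Seminorm.bound_of_continuous
    (ContDiffMapSupportedIn.withSeminorms ℝ (Euc d) ℝ ⊤ K) ((normSeminorm ℝ ℂ).comp T)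
    (continuous_norm.comp hT)
  -- The order is the largest one among the finitely many seminorms controlling `f` on `K`.
  refine ⟨s.sup id, C, C.2, fun h hh B hB hb => ?_⟩
  let h' : 𝓓_{K}(Euc d, ℝ) :=
    ContDiffMapSupportedIn.of_support_subset h.contDiff (subset_closure.trans hh)
  have key : ‖f h‖ ≤ C * (s.sup (ContDiffMapSupportedIn.seminorm ℝ (Euc d) ℝ ⊤ K)) h' := hC h'
  refine key.trans (mul_le_mul_of_nonneg_left ?_ C.2)
  refine Seminorm.finset_sup_apply_le hB fun i hi => ?_
  rw [ContDiffMapSupportedIn.seminorm_top_le_iff ℝ hB]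
  exact hb i (Finset.le_sup (f := id) hi)

/-- Leibniz moves the derivatives of `φ` into the constant; the real and imaginary parts are
estimated separately, whence the factor 2. -/
lemma exists_norm_localPairing_le {d : ℕ} (f : Distr d) (φ : TestFn d) :
    ∃ (L : ℕ) (C : ℝ), 0 ≤ C ∧ ∀ g, ‖localPairing f φ g‖ ≤ C * ‖jet (testSupport φ) L g‖ := by
  obtain ⟨L, C, hC, h⟩ := exists_norm_distribution_le f (testSupport φ)
  obtain ⟨A, hA, hφ⟩ := TestFunction.exists_norm_iteratedFDeriv_le φ L
  have key (P : ℂ →L[ℝ] ℝ) (hP : ‖P‖ = 1) (g : smoothFns d) :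
      ‖f (smoothMulTest φ (fun y => P (g.1 y)) (P.contDiff.comp (smoothFns_contDiff g)))‖ ≤
        C * (2 ^ L * (A * ‖jet (testSupport φ) L g‖)) := by
    refine h _ (closure_mono (Function.support_mul_subset_left _ _)) _ (by positivity)
      fun i hi x hx => ?_
    refine norm_iteratedFDeriv_mul_le_of_le φ.contDiff (P.contDiff.comp (smoothFns_contDiff g)) hi
      (fun j hj => hφ j hj x) fun j hj => ?_
    refine (P.norm_iteratedFDeriv_comp_left (smoothFns_contDiff g).contDiffAt
      (mod_cast le_top)).trans ?_
    rw [hP, one_mul]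
    exact norm_iteratedFDeriv_le_norm_jet _ _ _ hj hx
  refine ⟨L, 2 * (C * (2 ^ L * A)), by positivity, fun g => ?_⟩
  calc ‖localPairing f φ g‖ ≤ _ := norm_add_le _ _
    _ ≤ C * (2 ^ L * (A * ‖jet (testSupport φ) L g‖)) +
        C * (2 ^ L * (A * ‖jet (testSupport φ) L g‖)) := by
        refine add_le_add (key Complex.reCLM Complex.reCLM_norm g) ?_
        rw [norm_mul, Complex.norm_I, one_mul]
        exact key Complex.imCLM Complex.imCLM_norm g
    _ = _ := by ring

/-- A linear functional dominated by the norm of a linear map factors continuously through it. -/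
lemma exists_continuous_factorization {M E : Type*} [AddCommGroup M] [Module ℂ M]
    [NormedAddCommGroup E] [NormedSpace ℂ E] (T : M →ₗ[ℂ] E) (v : M →ₗ[ℂ] ℂ) {C : ℝ}
    (h : ∀ g, ‖v g‖ ≤ C * ‖T g‖) : ∃ Λ : E →L[ℂ] ℂ, ∀ g, v g = Λ (T g) := by
  have hker : LinearMap.ker T.rangeRestrict ≤ LinearMap.ker v := fun g hg => by
    have hg' : T g = 0 := by simpa using hg
    have := h g
    rw [hg', norm_zero, mul_zero] at this
    exact norm_le_zero_iff.1 this
  obtain ⟨w, hw⟩ := T.rangeRestrict.exists_rightInverse_of_surjective T.range_rangeRestrict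
  have hvw (g : M) : v (w (T.rangeRestrict g)) = v g := by
    rw [← sub_eq_zero, ← map_sub]
    refine hker ?_
    rw [LinearMap.mem_ker, map_sub, sub_eq_zero]
    exact LinearMap.congr_fun hw _
  have hb (x : LinearMap.range T) : ‖(v ∘ₗ w) x‖ ≤ C * ‖x‖ := by
    obtain ⟨_, g, rfl⟩ := x
    exact (congrArg norm (hvw g)).trans_le (h g)
  obtain ⟨Λ, hΛ, -⟩ := exists_extension_norm_eq (LinearMap.range T)
    ((v ∘ₗ w).mkContinuous C hb)
  exact ⟨Λ, fun g => (hvw g).symm.trans (hΛ (T.rangeRestrict g)).symm⟩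

/-! ### Characters and their jets -/

/-- The character `x ↦ exp (-2πi ⟨ξ, x⟩)`. -/
def charFn {d : ℕ} (ξ : Euc d) : smoothFns d :=
  ⟨fun x => Complex.exp ((-2 * Real.pi * inner ℝ ξ x : ℝ) * Complex.I), by
    change ContDiff ℝ ∞ _
    have h : ContDiff ℝ ∞ fun x : Euc d => ((-2 * Real.pi * inner ℝ ξ x : ℝ) : ℂ) :=
      Complex.ofRealCLM.contDiff.comp (contDiff_const.mul (contDiff_const.inner ℝ contDiff_id))
    fun_prop⟩

lemma charFn_apply {d : ℕ} (ξ x : Euc d) :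
    (charFn ξ).1 x = Complex.exp ((-2 * Real.pi * inner ℝ ξ x : ℝ) * Complex.I) := rfl

lemma norm_charFn {d : ℕ} (ξ x : Euc d) : ‖(charFn ξ).1 x‖ = 1 :=
  Complex.norm_exp_ofReal_mul_I _

lemma charFn_eq_fourierChar {d : ℕ} (ξ x : Euc d) :
    (charFn ξ).1 x = (Real.fourierChar (-inner ℝ ξ x) : ℂ) := by
  rw [charFn_apply, Real.fourierChar_apply]
  congr 2
  push_cast
  ring

/-- Up to the character itself, the `n`-th derivative of the character `charFn ξ`. -/
def charSymbol {d : ℕ} (n : ℕ) (ξ : Euc d) : Euc d [×n]→L[ℝ] ℂ :=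
  VectorFourier.fourierPowSMulRight (innerSL ℝ) (fun _ : Euc d => (1 : ℂ)) ξ n

lemma continuous_charSymbol {d : ℕ} (n : ℕ) :
    Continuous (charSymbol n : Euc d → Euc d [×n]→L[ℝ] ℂ) :=
  Continuous.fourierPowSMulRight (innerSL ℝ) continuous_const n

/-- The character is the Fourier integral of the constant 1 against the Dirac mass at `ξ`, so the
general formula for derivatives of Fourier integrals applies. -/
lemma iteratedFDeriv_charFn {d : ℕ} (ξ x : Euc d) (n : ℕ) :
    iteratedFDeriv ℝ n (charFn ξ).1 x = (charFn ξ).1 x • charSymbol n ξ := by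
  have hint (F : Type) [NormedAddCommGroup F] [NormedSpace ℂ F] [CompleteSpace F] (h : Euc d → F)
      (w : Euc d) : VectorFourier.fourierIntegral Real.fourierChar (Measure.dirac ξ)
        (ContinuousLinearMap.toLinearMap₁₂ (innerSL ℝ)) h w = (charFn ξ).1 w • h ξ := by
    rw [VectorFourier.fourierIntegral, integral_dirac, charFn_eq_fourierChar]
    rfl
  have h := VectorFourier.iteratedFDeriv_fourierIntegral (N := ⊤) (n := n) (μ := Measure.dirac ξ)
    (innerSL ℝ : Euc d →L[ℝ] Euc d →L[ℝ] ℝ) (f := fun _ => (1 : ℂ))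
    (fun n _ => integrable_dirac (by simp)) (by fun_prop) le_top
  have h1 : (charFn ξ).1 = VectorFourier.fourierIntegral Real.fourierChar (Measure.dirac ξ)
      (ContinuousLinearMap.toLinearMap₁₂ (innerSL ℝ : Euc d →L[ℝ] Euc d →L[ℝ] ℝ))
      fun _ => (1 : ℂ) := by
    ext w
    rw [hint, smul_eq_mul, mul_one]
  rw [h1, h, hint, ← h1]
  rfl

/-- Joint continuity in `(ξ, x)` becomes continuity in the sup norm over the compact `K`. -/
lemma continuous_jet_charFn {d : ℕ} (K : Compacts (Euc d)) (L : ℕ) :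
    Continuous fun ξ : Euc d => jet K L (charFn ξ) := by
  refine JetSpace.continuous_of_proj fun i =>
    ContinuousMap.continuous_of_continuous_uncurry
      (fun ξ : Euc d => JetSpace.proj i (jet K L (charFn ξ))) ?_
  have h : (Function.uncurry fun (ξ : Euc d) (x : K) => JetSpace.proj i (jet K L (charFn ξ)) x) =
      fun p : Euc d × K => (charFn p.1).1 (p.2 : Euc d) • charSymbol i p.1 := by
    ext1 p
    exact iteratedFDeriv_charFn _ _ _
  have h1 : Continuous fun p : Euc d × K => (charFn p.1).1 (p.2 : Euc d) := by
    simp only [charFn_apply]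
    fun_prop
  have h2 : Continuous fun p : Euc d × K => charSymbol (i : ℕ) p.1 :=
    (continuous_charSymbol (i : ℕ)).comp continuous_fst
  exact h.symm ▸ h1.smul h2

lemma exists_norm_jet_charFn_le {d : ℕ} (K : Compacts (Euc d)) (L : ℕ) :
    ∃ C : ℝ, 0 ≤ C ∧ ∀ ξ : Euc d, ‖jet K L (charFn ξ)‖ ≤ C * (1 + ‖ξ‖ ^ L) := by
  set A : ℝ := 2 * Real.pi * ‖(innerSL ℝ : Euc d →L[ℝ] Euc d →L[ℝ] ℝ)‖ with hA
  have hA0 : 0 ≤ A := by positivity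
  refine ⟨(1 + A) ^ L, by positivity, fun ξ => norm_jet_le _ _ _ (by positivity)
    fun i hi x _ => ?_⟩
  rw [iteratedFDeriv_charFn, norm_smul, norm_charFn, one_mul]
  calc ‖charSymbol i ξ‖ ≤ A ^ i * ‖ξ‖ ^ i * ‖(1 : ℂ)‖ :=
        VectorFourier.norm_fourierPowSMulRight_le _ _ _ _
    _ = A ^ i * ‖ξ‖ ^ i := by simp
    _ ≤ (1 + A) ^ L * (1 + ‖ξ‖ ^ L) := by
        gcongr
        · calc A ^ i ≤ (1 + A) ^ i := by gcongr; linarith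
            _ ≤ (1 + A) ^ L := pow_le_pow_right₀ (by linarith) hi
        · rcases le_total ‖ξ‖ 1 with h | h
          · exact (pow_le_one₀ (norm_nonneg _) h).trans (by simp)
          · exact (pow_le_pow_right₀ h hi).trans (by simp)

/-! ### The Fourier transform of `φ f` -/

/-- The Fourier transform of the compactly supported distribution `φ f`, as a function. -/
def localFourier {d : ℕ} (f : Distr d) (φ : TestFn d) (ξ : Euc d) : ℂ :=
  localPairing f φ (charFn ξ)

lemma continuous_localFourier {d : ℕ} (f : Distr d) (φ : TestFn d) :
    Continuous (localFourier f φ) := by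
  obtain ⟨L, C, -, h⟩ := exists_norm_localPairing_le f φ
  obtain ⟨Λ, hΛ⟩ := exists_continuous_factorization (jet _ L) (localPairing f φ) h
  have : localFourier f φ = fun ξ => Λ (jet _ L (charFn ξ)) := funext fun ξ => hΛ _
  rw [this]
  exact Λ.continuous.comp (continuous_jet_charFn _ _)

lemma exists_norm_localFourier_le {d : ℕ} (f : Distr d) (φ : TestFn d) :
    ∃ (L : ℕ) (C : ℝ), 0 ≤ C ∧ ∀ ξ, ‖localFourier f φ ξ‖ ≤ C * (1 + ‖ξ‖ ^ L) := by
  obtain ⟨L, C, hC, h⟩ := exists_norm_localPairing_le f φ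
  obtain ⟨C', hC', h'⟩ := exists_norm_jet_charFn_le (testSupport φ) L
  refine ⟨L, C * C', by positivity, fun ξ => (h _).trans ?_⟩
  rw [mul_assoc]
  exact mul_le_mul_of_nonneg_left (h' ξ) hC

/-- A Schwartz function, seen as a smooth function. -/
def schwartzToSmooth {d : ℕ} (g : 𝓢(Euc d, ℂ)) : smoothFns d := ⟨g, g.smooth ⊤⟩

lemma integrable_schwartz_mul_one_add_pow {d : ℕ} (g : 𝓢(Euc d, ℂ)) (C : ℝ) (L : ℕ) :
    Integrable fun ξ : Euc d => ‖g ξ‖ * (C * (1 + ‖ξ‖ ^ L)) := by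
  have h := ((g.integrable_pow_mul volume 0).add (g.integrable_pow_mul volume L)).const_mul C
  refine h.congr (Filter.Eventually.of_forall fun ξ => ?_)
  simp only [Pi.add_apply]
  ring

/-- Schwartz decay beats the polynomial growth of the jets, so the Fourier integral converges in the
Banach space of jets. Evaluation at each order and point reduces the identity to differentiation
under the integral. -/
lemma jet_fourier {d : ℕ} (K : Compacts (Euc d)) (L : ℕ) (g : 𝓢(Euc d, ℂ)) :
    Integrable (fun ξ => g ξ • jet K L (charFn ξ)) ∧
      jet K L (schwartzToSmooth (𝓕 g)) = ∫ ξ, g ξ • jet K L (charFn ξ) := by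
  have hint : Integrable (fun ξ => g ξ • jet K L (charFn ξ)) := by
    obtain ⟨C, -, h⟩ := exists_norm_jet_charFn_le K L
    refine (integrable_schwartz_mul_one_add_pow g C L).mono'
      (g.continuous.smul (continuous_jet_charFn K L)).aestronglyMeasurable
      (Filter.Eventually.of_forall fun ξ => ?_)
    rw [norm_smul]
    exact mul_le_mul_of_nonneg_left (h ξ) (norm_nonneg _)
  refine ⟨hint, ?_⟩
  refine JetSpace.ext fun i x => ?_
  let ev : JetSpace K L →L[ℂ] (Euc d [×i]→L[ℝ] ℂ) :=
    (ContinuousMap.evalCLM ℂ x).comp (JetSpace.proj i)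
  have h1 : JetSpace.proj i (∫ ξ, g ξ • jet K L (charFn ξ)) x =
      ∫ ξ, ev (g ξ • jet K L (charFn ξ)) :=
    (ev.integral_comp_comm hint).symm
  rw [h1, jet_apply]
  change iteratedFDeriv ℝ i (𝓕 (g : Euc d → ℂ)) (x : Euc d) = _
  rw [Real.iteratedFDeriv_fourier (N := ⊤) (fun n _ => g.integrable_pow_mul volume n)
    g.continuous.aestronglyMeasurable le_top, Real.fourier_eq]
  refine integral_congr_ae (Filter.Eventually.of_forall fun ξ => ?_)
  change _ = g ξ • JetSpace.proj i (jet K L (charFn ξ)) x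
  rw [jet_apply, iteratedFDeriv_charFn, charFn_eq_fourierChar, smul_comm]
  change (Real.fourierChar (-inner ℝ ξ (x : Euc d)) : ℂ) •
    VectorFourier.fourierPowSMulRight (innerSL ℝ) (g : Euc d → ℂ) ξ i = _
  congr 1
  ext m
  simp only [charSymbol, VectorFourier.fourierPowSMulRight_apply,
    _root_.smul_apply, smul_eq_mul, Complex.real_smul]
  ring

/-- Fubini for a distribution: once factored through jets, the pairing is a continuous functional
and commutes with the Bochner integral. -/
lemma localPairing_fourier {d : ℕ} (f : Distr d) (φ : TestFn d) (g : 𝓢(Euc d, ℂ)) :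
    localPairing f φ (schwartzToSmooth (𝓕 g)) = ∫ ξ, g ξ * localFourier f φ ξ := by
  obtain ⟨L, C, -, h⟩ := exists_norm_localPairing_le f φ
  obtain ⟨Λ, hΛ⟩ := exists_continuous_factorization (jet _ L) (localPairing f φ) h
  obtain ⟨h1, h2⟩ := jet_fourier (testSupport φ) L g
  rw [hΛ, h2, ← Λ.integral_comp_comm h1]
  refine integral_congr_ae (Filter.Eventually.of_forall fun ξ => ?_)
  simp only [map_smul, smul_eq_mul, localFourier, hΛ]

/-- The compactly supported distribution `φ f` as a tempered distribution. -/
def localTempered {d : ℕ} (f : Distr d) (φ : TestFn d) : 𝓢'(Euc d, ℂ) :=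
  ContinuousLinearMap.toPointwiseConvergenceCLM _ _ _ _ <|
    SchwartzMap.mkCLMtoNormedSpace (𝕜 := ℂ) (σ := RingHom.id ℂ)
      (fun g => localPairing f φ (schwartzToSmooth g))
      (fun g h => map_add (localPairing f φ) (schwartzToSmooth g) (schwartzToSmooth h))
      (fun c g => map_smul (localPairing f φ) c (schwartzToSmooth g)) (by
        obtain ⟨L, C, hC, h⟩ := exists_norm_localPairing_le f φ
        refine ⟨(Finset.range (L + 1)).image fun i => (0, i), C, hC, fun g => (h _).trans ?_⟩
        refine mul_le_mul_of_nonneg_left (norm_jet_le _ _ _ (apply_nonneg _ _)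
          fun i hi x _ => ?_) hC
        have h1 := SchwartzMap.le_seminorm ℂ 0 i g x
        rw [pow_zero, one_mul] at h1
        refine h1.trans ?_
        exact Seminorm.le_def.1 (Finset.le_sup (f := schwartzSeminormFamily ℂ (Euc d) ℂ)
          (Finset.mem_image_of_mem (fun i => (0, i))
            (Finset.mem_range.2 (by omega : i < L + 1)))) g)

lemma localTempered_apply {d : ℕ} (f : Distr d) (φ : TestFn d) (g : 𝓢(Euc d, ℂ)) :
    localTempered f φ g = localPairing f φ (schwartzToSmooth g) := rfl

lemma localTempered_testToSchwartz {d : ℕ} (f : Distr d) (φ g : TestFn d) :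
    localTempered f φ (testToSchwartz g) = f (mulTest φ g) := by
  rw [localTempered_apply]
  change f _ + Complex.I * f _ = _
  have h : smoothMulTest φ (fun y => ((schwartzToSmooth (testToSchwartz g)).1 y).im)
      (contDiff_im (schwartzToSmooth (testToSchwartz g))) = 0 := by
    ext y
    change φ y * ((g y : ℝ) : ℂ).im = 0
    simp
  rw [h, map_zero, mul_zero, add_zero]
  rfl

lemma fourier_localTempered_apply {d : ℕ} (f : Distr d) (φ : TestFn d) (g : 𝓢(Euc d, ℂ)) :
    𝓕 (localTempered f φ) g = ∫ ξ, g ξ * localFourier f φ ξ := by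
  rw [TemperedDistribution.fourier_apply, localTempered_apply, localPairing_fourier]

/-! ### Plancherel and the convolution formula -/

lemma integral_mul_fourierInv_eq {d : ℕ} {g W : Euc d → ℂ} (hg : Integrable g)
    (hW : Integrable W) : ∫ x, g x * 𝓕⁻ W x = ∫ ξ, 𝓕⁻ g ξ * W ξ := by
  have h := VectorFourier.integral_fourierIntegral_smul_eq_flip (μ := volume) (ν := volume)
    (L := -innerₗ (Euc d)) Real.continuous_fourierChar
    (by
      change Continuous fun p : Euc d × Euc d => -inner ℝ p.1 p.2
      fun_prop) hg hW
  have hflip : (-innerₗ (Euc d)).flip = -innerₗ (Euc d) := by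
    ext x y
    simp [real_inner_comm]
  rw [hflip] at h
  exact h.symm

/-- Plancherel's theorem for integrable, square-integrable functions with square-integrable
pointwise inverse Fourier transform. -/
lemma eLpNorm_fourierInv_eq {d : ℕ} {W : Euc d → ℂ} (h1 : Integrable W) (h2 : MemLp W 2 volume)
    (h3 : MemLp (𝓕⁻ W) 2 volume) : eLpNorm (𝓕⁻ W) 2 volume = eLpNorm W 2 volume := by
  have key : h3.toLp = 𝓕⁻ h2.toLp := by
    -- The pointwise and `L²` inverse transforms are identified as tempered distributions, by moving
    -- the transform onto the Schwartz function.
    have hinj := LinearMap.ker_eq_bot.1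
      (Lp.ker_toTemperedDistributionCLM_eq_bot (E := Euc d) (F := ℂ) (μ := volume) (p := 2))
    refine hinj ?_
    change (Lp.toTemperedDistribution h3.toLp : 𝓢'(Euc d, ℂ)) =
      Lp.toTemperedDistribution (𝓕⁻ h2.toLp)
    rw [← Lp.fourierInv_toTemperedDistribution_eq]
    ext g
    rw [TemperedDistribution.fourierInv_apply, Lp.toTemperedDistribution_apply,
      Lp.toTemperedDistribution_apply]
    have e1 : ∫ x, g x • (h3.toLp : Lp ℂ 2 (volume : Measure (Euc d))) x = ∫ x, g x * 𝓕⁻ W x := by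
      refine integral_congr_ae ?_
      filter_upwards [h3.coeFn_toLp] with x hx
      rw [hx, smul_eq_mul]
    have e2 : ∫ x, 𝓕⁻ g x • (h2.toLp : Lp ℂ 2 (volume : Measure (Euc d))) x =
        ∫ x, 𝓕⁻ (g : Euc d → ℂ) x * W x := by
      refine integral_congr_ae ?_
      filter_upwards [h2.coeFn_toLp] with x hx
      rw [hx, smul_eq_mul, SchwartzMap.fourierInv_coe]
    rw [e1, e2]
    exact integral_mul_fourierInv_eq g.integrable h1
  have hn : ‖h3.toLp‖ = ‖h2.toLp‖ := by
    rw [key, ← Lp.norm_fourier_eq, FourierTransform.fourier_fourierInv_eq]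
  rw [Lp.norm_toLp, Lp.norm_toLp] at hn
  exact (ENNReal.toReal_eq_toReal_iff' h3.eLpNorm_ne_top h2.eLpNorm_ne_top).1 hn

/-- The reflection `y ↦ x - y` turns the inverse transform into the direct one, the translation
gives the phase, and the factor `lam⁻ᵈ` cancels the Jacobian. -/
lemma fourierInv_rescaleTest {d : ℕ} (ρ : TestFn d) {lam : ℝ} (hlam : 0 < lam) (x ξ : Euc d) :
    (𝓕⁻ (testToSchwartz (rescaleTest ρ lam hlam x))) ξ =
      Complex.exp ((2 * Real.pi * inner ℝ ξ x : ℝ) * Complex.I) *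
        (𝓕 (testToSchwartz ρ)) (lam • ξ) := by
  rw [SchwartzMap.fourierInv_coe, SchwartzMap.fourier_coe, Real.fourierInv_eq', Real.fourier_eq']
  let G : Euc d → ℂ := fun z =>
    Complex.exp ((2 * Real.pi * inner ℝ (x - lam • z) ξ : ℝ) * Complex.I) *
      (((lam ^ d)⁻¹ * ρ z : ℝ) : ℂ)
  have h1 : (fun v => Complex.exp ((2 * Real.pi * inner ℝ v ξ : ℝ) * Complex.I) •
      testToSchwartz (rescaleTest ρ lam hlam x) v) = fun v => G (lam⁻¹ • (x - v)) := by
    ext v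
    change _ * (((lam ^ d)⁻¹ * ρ (lam⁻¹ • (x - v)) : ℝ) : ℂ) = _ * _
    rw [smul_inv_smul₀ hlam.ne', sub_sub_cancel]
  rw [h1, integral_sub_left_eq_self (fun v => G (lam⁻¹ • v)) volume x,
    Measure.integral_comp_inv_smul_of_nonneg _ _ hlam.le, finrank_euclideanSpace_fin,
    ← integral_const_mul, ← integral_smul]
  congr 1
  ext z
  change _ • (Complex.exp _ * _) = Complex.exp _ * (Complex.exp _ * ((ρ z : ℝ) : ℂ))
  rw [← mul_assoc, ← Complex.exp_add, inner_sub_left, real_inner_smul_left, real_inner_smul_right,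
    real_inner_comm x ξ, Complex.real_smul]
  have hl : (lam : ℂ) ^ d ≠ 0 := pow_ne_zero _ (Complex.ofReal_ne_zero.2 hlam.ne')
  push_cast
  rw [show (2 * Real.pi * (inner ℝ x ξ - lam * inner ℝ z ξ) * Complex.I : ℂ) =
      2 * Real.pi * inner ℝ x ξ * Complex.I +
        -2 * Real.pi * (lam * inner ℝ z ξ) * Complex.I by ring]
  field_simp

/-- The dilated Fourier transform of a test function, as a Schwartz function. -/
def dilatedFourier {d : ℕ} (ρ : TestFn d) (lam : ℝ) (hlam : 0 < lam) : 𝓢(Euc d, ℂ) :=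
  𝓕⁻ (testToSchwartz (rescaleTest ρ lam hlam 0))

lemma dilatedFourier_apply {d : ℕ} (ρ : TestFn d) {lam : ℝ} (hlam : 0 < lam) (ξ : Euc d) :
    dilatedFourier ρ lam hlam ξ = (𝓕 (testToSchwartz ρ)) (lam • ξ) := by
  rw [dilatedFourier, fourierInv_rescaleTest]
  simp

/-- Convolution theorem: Fourier inversion presents the rescaled test function as a Fourier
transform, to which `localPairing_fourier` applies. -/
lemma apply_mulTest_rescaleTest {d : ℕ} (f : Distr d) (φ ρ : TestFn d) {lam : ℝ} (hlam : 0 < lam)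
    (x : Euc d) : f (mulTest φ (rescaleTest ρ lam hlam x)) =
      𝓕⁻ (fun ξ => dilatedFourier ρ lam hlam ξ * localFourier f φ ξ) x := by
  rw [← localTempered_testToSchwartz, localTempered_apply,
    ← FourierTransform.fourier_fourierInv_eq (F := 𝓢(Euc d, ℂ))
      (testToSchwartz (rescaleTest ρ lam hlam x)),
    localPairing_fourier, Real.fourierInv_eq']
  congr 1
  ext ξ
  rw [fourierInv_rescaleTest, dilatedFourier_apply, smul_eq_mul, mul_assoc]

lemma integrable_schwartz_mul_localFourier {d : ℕ} (f : Distr d) (φ : TestFn d)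
    (S : 𝓢(Euc d, ℂ)) : Integrable fun ξ => S ξ * localFourier f φ ξ := by
  obtain ⟨L, C, -, hV⟩ := exists_norm_localFourier_le f φ
  refine (integrable_schwartz_mul_one_add_pow S C L).mono'
    (S.continuous.mul (continuous_localFourier f φ)).aestronglyMeasurable
    (Filter.Eventually.of_forall fun ξ => ?_)
  rw [norm_mul]
  exact mul_le_mul_of_nonneg_left (hV ξ) (norm_nonneg _)

/-- The product is both bounded and integrable. -/
lemma memLp_two_schwartz_mul_localFourier {d : ℕ} (f : Distr d) (φ : TestFn d)
    (S : 𝓢(Euc d, ℂ)) : MemLp (fun ξ => S ξ * localFourier f φ ξ) 2 volume := by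
  obtain ⟨L, C, hC, hV⟩ := exists_norm_localFourier_le f φ
  have hcont : Continuous fun ξ => S ξ * localFourier f φ ξ :=
    S.continuous.mul (continuous_localFourier f φ)
  rw [memLp_two_iff_integrable_sq_norm hcont.aestronglyMeasurable]
  set M : ℝ := C * (SchwartzMap.seminorm ℂ 0 0 S + SchwartzMap.seminorm ℂ L 0 S) with hM
  have hb (ξ : Euc d) : ‖S ξ * localFourier f φ ξ‖ ≤ M := by
    have h0 := SchwartzMap.le_seminorm ℂ 0 0 S ξ
    have hL := SchwartzMap.le_seminorm ℂ L 0 S ξ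
    rw [norm_iteratedFDeriv_zero] at h0 hL
    rw [norm_mul]
    calc ‖S ξ‖ * ‖localFourier f φ ξ‖ ≤ ‖S ξ‖ * (C * (1 + ‖ξ‖ ^ L)) := by gcongr; exact hV ξ
      _ = C * (‖ξ‖ ^ 0 * ‖S ξ‖ + ‖ξ‖ ^ L * ‖S ξ‖) := by ring
      _ ≤ M := by rw [hM]; gcongr
  refine ((integrable_schwartz_mul_localFourier f φ S).norm.const_mul M).mono'
    (hcont.norm.pow 2).aestronglyMeasurable (Filter.Eventually.of_forall fun ξ => ?_)
  rw [Real.norm_of_nonneg (by positivity), sq]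
  exact mul_le_mul_of_nonneg_right (hb ξ) (norm_nonneg _)

/-! ### The mollifier and the Besov levels -/

/-- There is a test function in the unit ball with integral one. -/
lemma exists_testFn_integral_eq_one (d : ℕ) :
    ∃ ρ : TestFn d, tsupport ρ ⊆ Metric.ball 0 1 ∧ ∫ x, ρ x = 1 := by
  let b : ContDiffBump (0 : Euc d) := ⟨1 / 4, 1 / 2, by norm_num, by norm_num⟩
  refine ⟨⟨b.normed volume, b.contDiff_normed, b.hasCompactSupport_normed, subset_univ _⟩,
    ?_, b.integral_normed⟩
  change tsupport (b.normed volume) ⊆ _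
  rw [b.tsupport_normed_eq]
  exact Metric.closedBall_subset_ball (by norm_num [b])

/-- The Fourier transform of a test function with integral one is bounded below near zero. -/
lemma exists_half_le_norm_fourier {d : ℕ} {ρ : TestFn d} (hρ : ∫ x, ρ x = 1) :
    ∃ c : ℝ, 0 < c ∧ ∀ ξ : Euc d, ‖ξ‖ ≤ c → 1 / 2 ≤ ‖(𝓕 (testToSchwartz ρ)) ξ‖ := by
  have h0 : (𝓕 (testToSchwartz ρ)) 0 = 1 := by
    rw [SchwartzMap.fourier_coe, Real.fourier_eq']
    simp only [inner_zero_right, mul_zero, Complex.ofReal_zero, zero_mul, Complex.exp_zero,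
      one_smul]
    change ∫ v, ((ρ v : ℝ) : ℂ) = 1
    rw [integral_complex_ofReal, hρ, Complex.ofReal_one]
  have hc : ContinuousAt (fun ξ : Euc d => ‖(𝓕 (testToSchwartz ρ)) ξ‖) 0 :=
    (𝓕 (testToSchwartz ρ)).continuous.norm.continuousAt
  have hev : ∀ᶠ ξ : Euc d in nhds 0, 1 / 2 < ‖(𝓕 (testToSchwartz ρ)) ξ‖ :=
    hc.eventually_const_lt (by simp only [h0]; norm_num)
  obtain ⟨ε, hε, h⟩ := Metric.eventually_nhds_iff.1 hev
  refine ⟨ε / 2, by positivity, fun ξ hξ => (h ?_).le⟩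
  rw [dist_zero_right]
  linarith

/-- Each derivative brings out a factor `lam ≤ 1`, so the bound is uniform in `x` and in the scale.
-/
lemma norm_iteratedFDeriv_comp_sub_smul_le {d : ℕ} (φ : TestFn d) (x : Euc d) {lam : ℝ}
    (h0 : 0 ≤ lam) (h1 : lam ≤ 1) (m : ℕ) {A : ℝ} (hA : ∀ y, ‖iteratedFDeriv ℝ m φ y‖ ≤ A)
    (z : Euc d) : ‖iteratedFDeriv ℝ m (fun z => φ (x - lam • z)) z‖ ≤ A := by
  have h : (fun z => φ (x - lam • z)) = fun z => (fun w => φ (x + w)) ((-lam) • z) := by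
    ext w
    simp only [neg_smul, ← sub_eq_add_neg]
  have hc : ContDiff ℝ m fun w => φ (x + w) :=
    (φ.contDiff.of_le (mod_cast le_top)).comp (contDiff_const.add contDiff_id)
  rw [h, iteratedFDeriv_comp_const_smul _ hc]
  beta_reduce
  rw [iteratedFDeriv_comp_add_left, norm_smul, norm_pow,
    norm_neg, Real.norm_of_nonneg h0]
  calc lam ^ m * ‖iteratedFDeriv ℝ m φ (x + -lam • z)‖ ≤ 1 * A := by
        gcongr
        · exact pow_le_one₀ h0 h1
        · exact hA _
    _ = A := one_mul A

lemma two_rpow_neg_nat_pos (n : ℕ) : (0 : ℝ) < (2 : ℝ) ^ (-(n : ℝ)) := by positivity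

lemma two_rpow_neg_nat_le_one (n : ℕ) : (2 : ℝ) ^ (-(n : ℝ)) ≤ 1 :=
  Real.rpow_le_one_of_one_le_of_nonpos one_le_two (by simp)

/-- Local averages of `φ f` at scale `2⁻ⁿ` are dominated by the Besov levels of `f`. -/
lemma exists_enorm_apply_mulTest_rescaleTest_le {d : ℕ} (r : ℕ) (α : ℝ) (f : Distr d)
    (φ : TestFn d) {ρ : TestFn d} (hρ : tsupport ρ ⊆ Metric.ball 0 1) :
    ∃ C : NNReal, ∀ (n : ℕ) (x : Euc d),
      ‖f (mulTest φ (rescaleTest ρ ((2 : ℝ) ^ (-(n : ℝ))) (two_rpow_neg_nat_pos n) x))‖ₑ ≤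
        C * (2 : ℝ≥0∞) ^ (-((n : ℝ) * α)) * besovLevel r α f n x := by
  obtain ⟨A, hA, hφ⟩ := TestFunction.exists_norm_iteratedFDeriv_le φ r
  obtain ⟨B, hB, hρ'⟩ := TestFunction.exists_norm_iteratedFDeriv_le ρ r
  set C : ℝ := 2 ^ r * (B * A) + 1 with hC
  have hC0 : 0 < C := by positivity
  refine ⟨NNReal.mk C hC0.le, fun n x => ?_⟩
  set lam : ℝ := (2 : ℝ) ^ (-(n : ℝ)) with hlam
  have hl0 : 0 < lam := two_rpow_neg_nat_pos n
  have hl1 : lam ≤ 1 := two_rpow_neg_nat_le_one n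
  have hcd : ContDiff ℝ ∞ fun z => φ (x - lam • z) :=
    φ.contDiff.comp (contDiff_const.sub (contDiff_id.const_smul lam))
  -- With `z = (x - y) / lam`, the value `φ y` is `φ (x - lam z)`: the cutoff becomes part of the
  -- profile being rescaled.
  let ψ : TestFn d := smoothMulTest ρ (fun z => φ (x - lam • z)) hcd
  have hψ : C⁻¹ • ψ ∈ unitTests d r := by
    constructor
    · refine (closure_mono ?_).trans hρ
      exact (Function.support_const_smul_subset _ _).trans (Function.support_mul_subset_left _ _)
    · intro m hm y
      have e : iteratedFDeriv ℝ m (C⁻¹ • ψ : TestFn d) y = C⁻¹ • iteratedFDeriv ℝ m ψ y :=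
        iteratedFDeriv_const_smul_apply (ψ.contDiff.of_le (mod_cast le_top)).contDiffAt
      have hb : ‖iteratedFDeriv ℝ m ψ y‖ ≤ 2 ^ r * (B * A) :=
        norm_iteratedFDeriv_mul_le_of_le ρ.contDiff hcd hm (fun i hi => hρ' i hi y)
          fun i hi => norm_iteratedFDeriv_comp_sub_smul_le φ x hl0.le hl1 i (hφ i hi) y
      rw [e, norm_smul, norm_inv, Real.norm_of_nonneg hC0.le, inv_mul_le_one₀ hC0]
      linarith
  have he : mulTest φ (rescaleTest ρ lam hl0 x) = C • rescaleTest (C⁻¹ • ψ) lam hl0 x := by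
    ext y
    change φ y * ((lam ^ d)⁻¹ * ρ (lam⁻¹ • (x - y))) = C * ((lam ^ d)⁻¹ * (C⁻¹ *
      (ρ (lam⁻¹ • (x - y)) * φ (x - lam • lam⁻¹ • (x - y)))))
    rw [smul_inv_smul₀ hl0.ne', sub_sub_cancel]
    field_simp
  rw [he, map_smul, enorm_smul, mul_assoc]
  have h2 : ‖C‖ₑ = (NNReal.mk C hC0.le : ℝ≥0∞) := by
    rw [Real.enorm_eq_ofReal hC0.le, ENNReal.ofReal_eq_coe_nnreal hC0.le]
  rw [h2]
  gcongr
  rw [mul_comm]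
  refine (ENNReal.div_le_iff (by simp [ENNReal.rpow_eq_zero_iff])
    (by simp [ENNReal.rpow_eq_top_iff])).1 ?_
  exact le_iSup₂ (f := fun ψ (_ : ψ ∈ unitTests d r) =>
    ‖f (rescaleTest ψ ((2 : ℝ) ^ (-(n : ℝ))) (by positivity) x)‖ₑ /
      (2 : ℝ≥0∞) ^ (-((n : ℝ) * α))) _ hψ

lemma mulTest_rescaleTest_eq_zero {d : ℕ} (φ : TestFn d) {ρ : TestFn d}
    (hρ : tsupport ρ ⊆ Metric.ball 0 1) {lam : ℝ} (hlam : 0 < lam) (h1 : lam ≤ 1) {x : Euc d}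
    (hx : x ∉ Metric.cthickening 1 (tsupport φ)) : mulTest φ (rescaleTest ρ lam hlam x) = 0 := by
  ext y
  change φ y * ((lam ^ d)⁻¹ * ρ (lam⁻¹ • (x - y))) = 0
  by_contra hne
  have hy : φ y ≠ 0 := left_ne_zero_of_mul hne
  have hz : ρ (lam⁻¹ • (x - y)) ≠ 0 := right_ne_zero_of_mul (right_ne_zero_of_mul hne)
  have hb := hρ (subset_tsupport _ hz)
  rw [mem_ball_zero_iff, norm_smul, norm_inv, Real.norm_of_nonneg hlam.le,
    inv_mul_lt_one₀ hlam] at hb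
  refine hx (Metric.mem_cthickening_of_dist_le x y 1 _ (subset_tsupport _ hy) ?_)
  rw [dist_eq_norm]
  linarith

lemma continuous_fourierInv_of_integrable {d : ℕ} {W : Euc d → ℂ} (hW : Integrable W) :
    Continuous (𝓕⁻ W) :=
  VectorFourier.fourierIntegral_continuous (L := -innerₗ (Euc d)) Real.continuous_fourierChar
    (by
      change Continuous fun p : Euc d × Euc d => -inner ℝ p.1 p.2
      fun_prop) hW

/-- The `L²` norm of a frequency-localized piece of the Fourier transform of `φ f` is controlled by
the local `L^p` norm of the Besov level. -/
lemma exists_eLpNorm_dilatedFourier_mul_le {d : ℕ} (r : ℕ) (α : ℝ) {p : ℝ≥0∞} (hp : 2 ≤ p)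
    (f : Distr d) (φ : TestFn d) {ρ : TestFn d} (hρ : tsupport ρ ⊆ Metric.ball 0 1) :
    ∃ C : ℝ≥0∞, C ≠ ⊤ ∧ ∀ n : ℕ,
      eLpNorm (fun ξ => dilatedFourier ρ ((2 : ℝ) ^ (-(n : ℝ))) (two_rpow_neg_nat_pos n) ξ *
        localFourier f φ ξ) 2 volume ≤
      C * (2 : ℝ≥0∞) ^ (-((n : ℝ) * α)) * eLpNorm (besovLevel r α f n) p
        (volume.restrict (Metric.cthickening 1 (tsupport φ))) := by
  set K := Metric.cthickening 1 (tsupport φ) with hK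
  have hKc : IsCompact K := IsCompact.cthickening φ.hasCompactSupport
  have hKv : volume.restrict K univ ≠ ⊤ := by
    rw [Measure.restrict_apply_univ]
    exact hKc.measure_lt_top.ne
  obtain ⟨C, hC⟩ := exists_enorm_apply_mulTest_rescaleTest_le r α f φ hρ
  -- Hölder exponent `1/2 - 1/p`; for `p = ⊤` the conventions `⊤.toReal = 0` and `1 / 0 = 0` give
  -- the correct `1/2`.
  set e : ℝ := 1 / (2 : ℝ≥0∞).toReal - 1 / p.toReal with he
  have he0 : 0 ≤ e := by
    rcases eq_or_ne p ⊤ with rfl | hp'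
    · simp [he]
    · rw [he, sub_nonneg]
      exact one_div_le_one_div_of_le (by simp) (ENNReal.toReal_mono hp' hp)
  refine ⟨C * volume.restrict K univ ^ e,
    ENNReal.mul_ne_top ENNReal.coe_ne_top (ENNReal.rpow_ne_top_of_nonneg he0 hKv), fun n => ?_⟩
  set W : Euc d → ℂ := fun ξ =>
    dilatedFourier ρ ((2 : ℝ) ^ (-(n : ℝ))) (two_rpow_neg_nat_pos n) ξ * localFourier f φ ξ with hW
  have hW1 : Integrable W := integrable_schwartz_mul_localFourier f φ _
  have hW2 : MemLp W 2 volume := memLp_two_schwartz_mul_localFourier f φ _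
  have hU (x : Euc d) : 𝓕⁻ W x =
      f (mulTest φ (rescaleTest ρ ((2 : ℝ) ^ (-(n : ℝ))) (two_rpow_neg_nat_pos n) x)) :=
    (apply_mulTest_rescaleTest f φ ρ _ x).symm
  have hUc : Continuous (𝓕⁻ W) := continuous_fourierInv_of_integrable hW1
  have hU0 (x : Euc d) (hx : x ∉ K) : 𝓕⁻ W x = 0 := by
    rw [hU, mulTest_rescaleTest_eq_zero φ hρ _ (two_rpow_neg_nat_le_one n) hx, map_zero]
  have hU2 : MemLp (𝓕⁻ W) 2 volume :=
    hUc.memLp_of_hasCompactSupport (HasCompactSupport.intro hKc hU0)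
  have hc : (2 : ℝ≥0∞) ^ (-((n : ℝ) * α)) ≠ ⊤ := by simp [ENNReal.rpow_eq_top_iff]
  rw [← eLpNorm_fourierInv_eq hW1 hW2 hU2,
    ← eLpNorm_restrict_eq_of_support_subset (Function.support_subset_iff'.2 hU0)]
  calc eLpNorm (𝓕⁻ W) 2 (volume.restrict K)
      ≤ eLpNorm (𝓕⁻ W) p (volume.restrict K) * volume.restrict K univ ^ e :=
        eLpNorm_le_eLpNorm_mul_rpow_measure_univ hp hUc.aestronglyMeasurable
    _ ≤ (C * (2 : ℝ≥0∞) ^ (-((n : ℝ) * α)) * eLpNorm (besovLevel r α f n) p (volume.restrict K)) *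
        volume.restrict K univ ^ e := by
        gcongr
        have h := eLpNorm_le_mul_eLpNorm_of_ae_le_mul' (f := 𝓕⁻ W) (g := besovLevel r α f n)
          (c := C * ((2 : ℝ≥0∞) ^ (-((n : ℝ) * α))).toNNReal) (μ := volume.restrict K)
          (Filter.Eventually.of_forall fun x => by
            rw [ENNReal.coe_mul, ENNReal.coe_toNNReal hc, hU, enorm_eq_self]
            exact hC n x) p
        rwa [ENNReal.coe_mul, ENNReal.coe_toNNReal hc] at h
    _ = _ := by ring

/-! ### From dyadic pieces to the Sobolev weight -/

/-- For negative `s`, the weight `(1 + ‖ξ‖²)^{s/2}` is dominated by the dyadic weight `2^{ns}` at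
some scale `n` at which `ξ` is low-frequency. -/
lemma exists_scale_rpow_le {E : Type*} [NormedAddCommGroup E] {c s : ℝ} (hc : 0 < c)
    (hs : s < 0) (ξ : E) : ∃ n : ℕ, (2 : ℝ) ^ (-(n : ℝ)) * ‖ξ‖ ≤ c ∧
      (1 + ‖ξ‖ ^ 2) ^ (s / 2) ≤ (1 + (c / 2) ^ s) * (2 : ℝ) ^ ((n : ℝ) * s) := by
  have hex : ∃ n : ℕ, (2 : ℝ) ^ (-(n : ℝ)) * ‖ξ‖ ≤ c := by
    obtain ⟨n, hn⟩ := pow_unbounded_of_one_lt (‖ξ‖ / c) one_lt_two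
    refine ⟨n, ?_⟩
    rw [Real.rpow_neg zero_le_two, Real.rpow_natCast, inv_mul_le_iff₀ (by positivity)]
    exact ((div_lt_iff₀ hc).1 hn).le
  classical
  have hcs : 0 ≤ (c / 2) ^ s := by positivity
  -- The least admissible scale: if it is `n + 1`, failure at `n` gives `‖ξ‖ > c 2ⁿ`, the lower
  -- bound needed for a negative power. At scale 0 the weight is at most 1, covered by the `1 +` in
  -- the constant.
  refine ⟨Nat.find hex, Nat.find_spec hex, ?_⟩
  rcases hn : Nat.find hex with _ | n
  · have h1 : (1 + ‖ξ‖ ^ 2) ^ (s / 2) ≤ 1 :=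
      Real.rpow_le_one_of_one_le_of_nonpos (by linarith [sq_nonneg ‖ξ‖]) (by linarith)
    simp only [Nat.cast_zero, zero_mul, Real.rpow_zero, mul_one]
    linarith
  · have hlt : ¬ (2 : ℝ) ^ (-(n : ℝ)) * ‖ξ‖ ≤ c := Nat.find_min hex (by omega)
    rw [Real.rpow_neg zero_le_two, Real.rpow_natCast, inv_mul_le_iff₀ (by positivity),
      not_le] at hlt
    have hpos : 0 < c / 2 * 2 ^ (n + 1) := by positivity
    calc (1 + ‖ξ‖ ^ 2) ^ (s / 2) ≤ ((c / 2 * 2 ^ (n + 1)) ^ 2) ^ (s / 2) := by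
          refine Real.rpow_le_rpow_of_nonpos (by positivity) ?_ (by linarith)
          have h : c / 2 * 2 ^ (n + 1) ≤ ‖ξ‖ := by
            rw [pow_succ]
            linarith
          have := pow_le_pow_left₀ hpos.le h 2
          linarith
      _ = (c / 2 * 2 ^ (n + 1)) ^ s := by
          rw [← Real.rpow_natCast (c / 2 * 2 ^ (n + 1)) 2, ← Real.rpow_mul hpos.le]
          congr 1
          push_cast
          ring
      _ = (c / 2) ^ s * (2 : ℝ) ^ (((n + 1 : ℕ) : ℝ) * s) := by
          rw [Real.mul_rpow (by positivity) (by positivity), Real.rpow_mul zero_le_two,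
            Real.rpow_natCast]
      _ ≤ _ := by
          gcongr
          linarith

lemma enorm_two_rpow (t : ℝ) : ‖(2 : ℝ) ^ t‖ₑ = (2 : ℝ≥0∞) ^ t := by
  rw [Real.enorm_eq_ofReal (by positivity), ← ENNReal.ofReal_rpow_of_pos two_pos,
    ENNReal.ofReal_ofNat]

/-- The weighted Fourier transform of `φ f` is square-integrable if its frequency-localized pieces
are square-summable with the corresponding dyadic weights. -/
lemma memLp_weighted_localFourier {d : ℕ} {s : ℝ} (hs : s < 0) (f : Distr d) (φ : TestFn d)
    {ρ : TestFn d} (hρ : ∫ x, ρ x = 1)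
    (hsum : ∑' n : ℕ, ((2 : ℝ≥0∞) ^ ((n : ℝ) * s) * eLpNorm (fun ξ =>
      dilatedFourier ρ ((2 : ℝ) ^ (-(n : ℝ))) (two_rpow_neg_nat_pos n) ξ *
        localFourier f φ ξ) 2 volume) ^ 2 ≠ ⊤) :
    MemLp (fun ξ => (((1 + ‖ξ‖ ^ 2) ^ (s / 2) : ℝ) : ℂ) * localFourier f φ ξ) 2 volume := by
  have hV := continuous_localFourier f φ
  have hw : Continuous fun ξ : Euc d => (((1 + ‖ξ‖ ^ 2) ^ (s / 2) : ℝ) : ℂ) :=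
    Complex.continuous_ofReal.comp (Continuous.rpow_const (by fun_prop)
      fun ξ => Or.inl (by positivity))
  refine ⟨(hw.mul hV).aestronglyMeasurable, ?_⟩
  rw [eLpNorm_lt_top_iff_lintegral_rpow_enorm_lt_top two_ne_zero ENNReal.ofNat_ne_top]
  simp only [ENNReal.toReal_ofNat, ENNReal.rpow_ofNat]
  obtain ⟨c, hc, hlow⟩ := exists_half_le_norm_fourier hρ
  set W : ℕ → Euc d → ℂ := fun n ξ => dilatedFourier ρ ((2 : ℝ) ^ (-(n : ℝ)))
    (two_rpow_neg_nat_pos n) ξ * localFourier f φ ξ with hW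
  have hWm (n : ℕ) : Measurable fun ξ => ‖W n ξ‖ₑ :=
    ((dilatedFourier ρ _ (two_rpow_neg_nat_pos n)).continuous.mul hV).measurable.enorm
  -- The 2 compensates for the lower bound `1/2` on the transform of `ρ`.
  set A : ℝ := 2 * (1 + (c / 2) ^ s) with hA
  have hA0 : 0 ≤ A := by positivity
  -- A single term of the series, at a scale depending on `ξ`, already dominates.
  have hpt (ξ : Euc d) : ‖(((1 + ‖ξ‖ ^ 2) ^ (s / 2) : ℝ) : ℂ) * localFourier f φ ξ‖ₑ ^ 2 ≤
      ‖A‖ₑ ^ 2 * ∑' n : ℕ, ((2 : ℝ≥0∞) ^ ((n : ℝ) * s) * ‖W n ξ‖ₑ) ^ 2 := by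
    obtain ⟨n, hn1, hn2⟩ := exists_scale_rpow_le hc hs ξ
    have hl : 1 / 2 ≤ ‖dilatedFourier ρ ((2 : ℝ) ^ (-(n : ℝ))) (two_rpow_neg_nat_pos n) ξ‖ := by
      rw [dilatedFourier_apply]
      refine hlow _ ?_
      rwa [norm_smul, Real.norm_of_nonneg (two_rpow_neg_nat_pos n).le]
    have hreal : ‖(((1 + ‖ξ‖ ^ 2) ^ (s / 2) : ℝ) : ℂ) * localFourier f φ ξ‖ ≤
        ‖((A * (2 : ℝ) ^ ((n : ℝ) * s) : ℝ) : ℂ) * W n ξ‖ := by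
      rw [norm_mul, norm_mul, norm_mul, Complex.norm_real, Complex.norm_real,
        Real.norm_of_nonneg (by positivity), Real.norm_of_nonneg (by positivity), ← mul_assoc]
      refine mul_le_mul_of_nonneg_right ?_ (norm_nonneg _)
      calc (1 + ‖ξ‖ ^ 2) ^ (s / 2) ≤ (1 + (c / 2) ^ s) * (2 : ℝ) ^ ((n : ℝ) * s) := hn2
        _ = A * (2 : ℝ) ^ ((n : ℝ) * s) * (1 / 2) := by rw [hA]; ring
        _ ≤ _ := by gcongr
    have hen := enorm_le_iff_norm_le.2 hreal
    have hA' : ‖((A * (2 : ℝ) ^ ((n : ℝ) * s) : ℝ) : ℂ)‖ₑ = ‖A * (2 : ℝ) ^ ((n : ℝ) * s)‖ₑ :=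
      enorm_eq_iff_norm_eq.2 (Complex.norm_real _)
    rw [enorm_mul _ (W n ξ), hA', enorm_mul A, enorm_two_rpow, mul_assoc] at hen
    calc _ ≤ (‖A‖ₑ * ((2 : ℝ≥0∞) ^ ((n : ℝ) * s) * ‖W n ξ‖ₑ)) ^ 2 := by gcongr
      _ = ‖A‖ₑ ^ 2 * ((2 : ℝ≥0∞) ^ ((n : ℝ) * s) * ‖W n ξ‖ₑ) ^ 2 := mul_pow _ _ _
      _ ≤ _ := by
          gcongr
          exact ENNReal.le_tsum (f := fun n : ℕ => ((2 : ℝ≥0∞) ^ ((n : ℝ) * s) * ‖W n ξ‖ₑ) ^ 2) n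
  refine (lintegral_mono hpt).trans_lt ?_
  have hm (n : ℕ) : Measurable fun ξ => ((2 : ℝ≥0∞) ^ ((n : ℝ) * s) * ‖W n ξ‖ₑ) ^ 2 :=
    ((hWm n).const_mul _).pow_const 2
  rw [lintegral_const_mul _ (Measurable.tsum hm),
    lintegral_tsum fun n => (hm n).aemeasurable]
  refine ENNReal.mul_lt_top (ENNReal.pow_lt_top enorm_lt_top) (lt_top_iff_ne_top.2 ?_)
  convert hsum using 3 with n
  simp only [mul_pow]
  rw [lintegral_const_mul _ ((hWm n).pow_const 2),
    eLpNorm_eq_lintegral_rpow_enorm_toReal two_ne_zero ENNReal.ofNat_ne_top]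
  congr 1
  simp only [ENNReal.toReal_ofNat, ENNReal.rpow_ofNat]
  rw [← ENNReal.rpow_two, ← ENNReal.rpow_mul, one_div_mul_cancel two_ne_zero, ENNReal.rpow_one]

lemma memSobolev_localTempered {d : ℕ} {s : ℝ} {f : Distr d} {φ : TestFn d}
    (h : MemLp (fun ξ => (((1 + ‖ξ‖ ^ 2) ^ (s / 2) : ℝ) : ℂ) * localFourier f φ ξ) 2 volume) :
    TemperedDistribution.MemSobolev s 2 (localTempered f φ) := by
  rw [TemperedDistribution.memSobolev_iff_exists_smulLeftCLM_fourier]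
  refine ⟨h.toLp, ?_⟩
  ext g
  rw [TemperedDistribution.smulLeftCLM_apply_apply, fourier_localTempered_apply,
    Lp.toTemperedDistribution_apply]
  refine integral_congr_ae ?_
  filter_upwards [h.coeFn_toLp] with ξ hξ
  rw [hξ, SchwartzMap.smulLeftCLM_apply_apply (by fun_prop), smul_eq_mul, smul_eq_mul]
  ring

/-! ### Summation over the scales -/

/-- A dyadic summability condition on the Besov levels implies local Sobolev regularity. -/
lemma mem_sobolevLoc_of_tsum_ne_top {d r : ℕ} {α s : ℝ} (hs : s < 0) {p : ℝ≥0∞} (hp : 2 ≤ p)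
    {f : Distr d}
    (h : ∀ K : Set (Euc d), IsCompact K → ∑' n : ℕ, ((2 : ℝ≥0∞) ^ ((n : ℝ) * (s - α)) *
      eLpNorm (besovLevel r α f n) p (volume.restrict K)) ^ 2 ≠ ⊤) : f ∈ sobolevLoc d s := by
  intro φ
  refine ⟨localTempered f φ, localTempered_testToSchwartz f φ, memSobolev_localTempered ?_⟩
  obtain ⟨ρ, hρ, hρ1⟩ := exists_testFn_integral_eq_one d
  refine memLp_weighted_localFourier hs f φ hρ1 ?_
  obtain ⟨C, hC, hle⟩ := exists_eLpNorm_dilatedFourier_mul_le r α hp f φ hρ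
  have hK := h _ (φ.hasCompactSupport.cthickening (r := 1))
  refine ne_top_of_le_ne_top (ENNReal.mul_ne_top (ENNReal.pow_ne_top (n := 2) hC) hK) ?_
  rw [← ENNReal.tsum_mul_left]
  refine ENNReal.tsum_le_tsum fun n => ?_
  rw [← mul_pow]
  refine pow_le_pow_left' ((mul_le_mul_right (hle n) _).trans_eq ?_) 2
  rw [mul_sub, sub_eq_add_neg, ENNReal.rpow_add _ _ two_ne_zero ENNReal.ofNat_ne_top]
  ring

end

theorem mainTheorem4 (d : ℕ) (hd : 1 ≤ d) (α : ℝ) (hα : α < 0) (r : ℕ) (hr : -α < (r : ℝ))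
    (p : ℝ≥0∞) (hp : 2 ≤ p) :
    (∀ q : ℝ≥0∞, 2 < q → ∀ s : ℝ, s < α → besovLocNeg d r α p q ⊆ sobolevLoc d s) ∧
    (∀ s : ℝ, s ≤ α → besovLocNeg d r α p 2 ⊆ sobolevLoc d s) := by
  constructor
  · intro q hq s hs f hf
    refine mem_sobolevLoc_of_tsum_ne_top (r := r) (α := α) (hs.trans hα) hp fun K hK => ?_
    set B := eLpNorm (fun n : ℕ => eLpNorm (besovLevel r α f n) p (volume.restrict K)) q
      Measure.count with hB
    have hBtop : B ≠ ⊤ := (hf K hK).ne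
    -- Only `ℓ^q ⊆ ℓ^∞` is needed; the strict gain `s < α` supplies summability.
    have hb (n : ℕ) : eLpNorm (besovLevel r α f n) p (volume.restrict K) ≤ B :=
      enorm_le_eLpNorm_count (fun n : ℕ => eLpNorm (besovLevel r α f n) p (volume.restrict K)) n
        (zero_lt_two.trans hq).ne'
    have hlt : ((2 : ℝ≥0∞) ^ (s - α)) ^ 2 < 1 :=
      pow_lt_one' (ENNReal.rpow_lt_one_of_one_lt_of_neg ENNReal.one_lt_two (by linarith))
        two_ne_zero
    refine ne_top_of_le_ne_top (ENNReal.mul_ne_top (tsum_geometric_lt_top.2 hlt).ne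
      (ENNReal.pow_ne_top (n := 2) hBtop)) ?_
    rw [← ENNReal.tsum_mul_right]
    refine ENNReal.tsum_le_tsum fun n => ?_
    rw [mul_pow]
    refine mul_le_mul' (le_of_eq ?_) (pow_le_pow_left' (hb n) 2)
    rw [mul_comm, ENNReal.rpow_mul, ENNReal.rpow_natCast, ← pow_mul, ← pow_mul, mul_comm]
  · intro s hs f hf
    refine mem_sobolevLoc_of_tsum_ne_top (r := r) (α := α) (hs.trans_lt hα) hp fun K hK => ?_
    have h := lintegral_rpow_enorm_lt_top_of_eLpNorm_lt_top two_ne_zero ENNReal.ofNat_ne_top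
      (hf K hK)
    rw [lintegral_count] at h
    refine ne_top_of_le_ne_top h.ne (ENNReal.tsum_le_tsum fun n => ?_)
    rw [enorm_eq_self, ENNReal.toReal_ofNat, ENNReal.rpow_ofNat]
    -- The dyadic weight is at most 1 since `s ≤ α`, so the `ℓ²` sum dominates termwise.
    refine pow_le_pow_left' (mul_le_of_le_one_left' ?_) 2
    rw [← ENNReal.rpow_zero (x := 2)]
    exact ENNReal.rpow_le_rpow_of_exponent_le one_le_two
      (mul_nonpos_of_nonneg_of_nonpos n.cast_nonneg (by linarith))
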